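/- Let $n$ be a natural number and let $A$ and $B$ be complex $n\times n$ matrices. A complex matrix is called positive if all its entries are nonnegative real numbers, and $A$ and $B$ are said to semi-commute if $AB-BA$ or $-(AB-BA)$ is positive. An order ideal of $\mathbb R^n$ is a linear subspace $\mathcal J\subseteq\mathbb R^n$ such that $x\in\mathcal J$ and $|y|\le |x|$ (componentwise) imply $y\in\mathcal J$. A matrix is ideal-irreducible if no order ideal $\mathcal J$ of $\mathbb R^n$ with $\{0\}\ne\mathcal J\ne\mathbb R^n$ is invariant under it (for a non-real matrix $M$, invariance means $M\mathcal J\subseteq \mathcal J+i\mathcal J$). If $A$ and $B$ semi-commute and at least one of the matrices $A$ and $B$ is positive and ideal-irreducible, then $AB=BA$, and the unital subalgebra of $M_n(\mathbb C)$ generated by $A$ and $B$ has dimension at most $n$ over $\mathbb C$. -/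

import Mathlib

open scoped ComplexOrder in
/-- A complex matrix is positive if all of its entries are nonnegative real numbers
(in the order of `ℂ`, `0 ≤ z` means that `z` is real and nonnegative). -/
def IsPositiveMatrix {n : ℕ} (A : Matrix (Fin n) (Fin n) ℂ) : Prop :=
  ∀ i j, 0 ≤ A i j

/-- `A` and `B` semi-commute if the commutator `AB - BA` is positive or negative. -/
def SemiCommute {n : ℕ} (A B : Matrix (Fin n) (Fin n) ℂ) : Prop :=
  IsPositiveMatrix (A * B - B * A) ∨ IsPositiveMatrix (-(A * B - B * A))

/-- An order ideal of `ℝⁿ` with the componentwise order: a vector subspace `J` such that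
`x ∈ J` and `|y| ≤ |x|` imply `y ∈ J`. -/
def IsOrderIdeal {n : ℕ} (J : Submodule ℝ (Fin n → ℝ)) : Prop :=
  LatticeOrderedAddCommGroup.IsSolid (J : Set (Fin n → ℝ))

/-- The subspace `J` of `ℝⁿ` is invariant under the complex matrix `A`: for `x ∈ J` the vector
`Ax` lies in `J + iJ`, that is, its real and imaginary parts lie in `J`. If `A` is real, this
says that `Ax ∈ J` for all `x ∈ J`. -/
def IsInvariantUnder {n : ℕ} (J : Submodule ℝ (Fin n → ℝ)) (A : Matrix (Fin n) (Fin n) ℂ) :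
    Prop :=
  ∀ x ∈ J, (fun i => (A.mulVec (fun j => (x j : ℂ)) i).re) ∈ J ∧
    (fun i => (A.mulVec (fun j => (x j : ℂ)) i).im) ∈ J

/-- `A` is ideal-reducible if some nontrivial order ideal of `ℝⁿ` is invariant under `A`. -/
def IsIdealReducible {n : ℕ} (A : Matrix (Fin n) (Fin n) ℂ) : Prop :=
  ∃ J : Submodule ℝ (Fin n → ℝ), IsOrderIdeal J ∧ J ≠ ⊥ ∧ J ≠ ⊤ ∧ IsInvariantUnder J A

/-- `A` is ideal-irreducible if it is not ideal-reducible. -/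
def IsIdealIrreducible {n : ℕ} (A : Matrix (Fin n) (Fin n) ℂ) : Prop :=
  ¬ IsIdealReducible A

/-! Let `A` be the positive irreducible matrix and `C` the commutator, up to sign. Each `C * A ^ k`
has trace zero and nonnegative entries, and irreducibility gives every `(j, i)` a `k` with `(A ^ k)
j i ≠ 0`; this forces `C i j = 0`. The dimension bound is then Gerstenhaber's theorem, where
positivity plays no role. It is clear when one matrix has a cyclic vector. In general `A` commutes
with some cyclic `R`, and `B + t R` is cyclic for all but finitely many `t`. Linear independence is
an open condition, so `n + 1` independent polynomials in `A, B` would stay independent in `A, B + t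
R` for small `t`, which is impossible. -/

open Polynomial

/-! ### Krylov matrices and cyclic vectors -/

/-- The Krylov matrix of `M` and `v`: its columns are `v, M v, M² v, …`. -/
def krylov {S : Type*} [CommRing S] {n : ℕ} (M : Matrix (Fin n) (Fin n) S) (v : Fin n → S) :
    Matrix (Fin n) (Fin n) S :=
  Matrix.of fun i k => (M ^ (k : ℕ)).mulVec v i

theorem krylov_map {S T : Type*} [CommRing S] [CommRing T] {n : ℕ} (f : S →+* T)
    (M : Matrix (Fin n) (Fin n) S) (v : Fin n → S) :
    f.mapMatrix (krylov M v) = krylov (f.mapMatrix M) (f ∘ v) := by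
  ext i k
  simp only [krylov, RingHom.mapMatrix_apply, Matrix.map_apply, Matrix.of_apply,
    RingHom.map_mulVec, ← Matrix.map_pow]

theorem mul_krylov_of_commute {S : Type*} [CommRing S] {n : ℕ} {P M : Matrix (Fin n) (Fin n) S}
    (h : Commute P M) (v : Fin n → S) (hv : P.mulVec v = 0) : P * krylov M v = 0 := by
  ext i k
  have : (P * krylov M v) i k = P.mulVec ((M ^ (k : ℕ)).mulVec v) i := rfl
  rw [this, Matrix.mulVec_mulVec, (h.pow_right k).eq, ← Matrix.mulVec_mulVec, hv,
    Matrix.mulVec_zero]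
  rfl

/-- If `v` is a cyclic vector of `M`, a matrix commuting with `M` is determined by its value
at `v`, so at most `n` such matrices are linearly independent. -/
theorem card_le_of_linearIndependent_of_commute {K : Type*} [Field K] {n m : ℕ}
    {M : Matrix (Fin n) (Fin n) K} {v : Fin n → K} (hv : (krylov M v).det ≠ 0)
    {P : Fin m → Matrix (Fin n) (Fin n) K} (hP : LinearIndependent K P)
    (hc : ∀ k, Commute (P k) M) : m ≤ n := by
  have hinj : LinearIndependent K fun k => (P k).mulVec v := by
    rw [Fintype.linearIndependent_iff] at hP ⊢
    intro g hg
    refine hP g ?_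
    have h0 : (∑ k, g k • P k).mulVec v = 0 := by
      rw [← hg, Matrix.sum_mulVec]
      simp only [Matrix.smul_mulVec]
    have hcomm : Commute (∑ k, g k • P k) M :=
      Commute.sum_left _ _ _ fun k _ => (hc k).smul_left _
    have h1 := mul_krylov_of_commute hcomm v h0
    have hu : IsUnit (krylov M v) := (Matrix.isUnit_iff_isUnit_det _).2 hv.isUnit
    exact hu.mul_left_eq_zero.1 h1
  simpa using hinj.fintype_card_le_finrank

/-- By Cayley–Hamilton `p` can be reduced modulo the characteristic polynomial, so the first `n`
powers of `M` already reach every `w`. -/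
theorem krylov_det_ne_zero {K : Type*} [Field K] {n : ℕ} {M : Matrix (Fin n) (Fin n) K}
    {v : Fin n → K} (h : ∀ w, ∃ p : K[X], (aeval M p).mulVec v = w) : (krylov M v).det ≠ 0 := by
  have hs : Function.Surjective (krylov M v).mulVec := by
    intro w
    obtain ⟨p, rfl⟩ := h w
    have hdeg : (p %ₘ M.charpoly).natDegree < n ∨ n = 0 := by
      rcases Nat.eq_zero_or_pos n with h0 | h0
      · exact Or.inr h0
      · left
        have := natDegree_modByMonic_lt p M.charpoly_monic (by
          intro h1
          have h2 := M.charpoly_natDegree_eq_dim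
          rw [h1] at h2
          simp at h2
          omega)
        simpa [M.charpoly_natDegree_eq_dim] using this
    rcases hdeg with hdeg | rfl
    · refine ⟨fun k => (p %ₘ M.charpoly).coeff k, ?_⟩
      have hp : aeval M p = aeval M (p %ₘ M.charpoly) := by
        conv_lhs => rw [← modByMonic_add_div p M.charpoly]
        simp [Matrix.aeval_self_charpoly]
      rw [hp, aeval_eq_sum_range' hdeg, Matrix.sum_mulVec, ← Fin.sum_univ_eq_sum_range
        (fun k => ((p %ₘ M.charpoly).coeff k • M ^ k).mulVec v)]
      ext i
      simp only [Matrix.mulVec_eq_sum, Finset.sum_apply, krylov, Pi.smul_apply]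
      simp [mul_comm, mul_assoc, Finset.mul_sum]
    · exact ⟨0, Subsingleton.elim _ _⟩
  exact ((Matrix.isUnit_iff_isUnit_det _).1 (Matrix.mulVec_surjective_iff_isUnit.1 hs)).ne_zero

/-- If `v` is a cyclic vector of `R`, it is one of `R + s B` for all but finitely many `s`. -/
theorem finite_setOf_krylov_det_eq_zero {K : Type*} [Field K] {n : ℕ}
    {R : Matrix (Fin n) (Fin n) K} {v : Fin n → K} (h : (krylov R v).det ≠ 0)
    (B : Matrix (Fin n) (Fin n) K) : {s : K | (krylov (R + s • B) v).det = 0}.Finite := by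
  -- The determinant is a polynomial in `s`, nonzero at `s = 0`.
  set q : K[X] := (krylov (R.map C + (X : K[X]) • B.map C) (C ∘ v)).det with hq
  have hev (s : K) : q.eval s = (krylov (R + s • B) v).det := by
    rw [hq, ← coe_evalRingHom, RingHom.map_det, krylov_map]
    congr 2
    · ext i j
      simp
      ring
    · ext i
      simp
  have hq0 : q ≠ 0 := by
    intro h0
    have := hev 0
    rw [h0] at this
    simp at this
    exact h this.symm
  refine (q.rootSet_finite K).subset fun s hs => ?_
  rw [Set.mem_ofPred_eq] at hs
  rw [mem_rootSet_of_ne hq0, coe_aeval_eq_eval, hev, hs]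

/-! ### Cyclic matrices in a centralizer -/

/-- Split `V` into summands `K[X] ⧸ (X - a i) ^ d i` and let `g` act on each as `X + c i`. The
shifts make the eigenvalues `ξ i` distinct, so by the Chinese remainder theorem the vector of all
ones is cyclic. -/
theorem exists_cyclic_commuting_end {K V : Type*} [Field K] [IsAlgClosed K] [AddCommGroup V]
    [Module K V] [FiniteDimensional K V] (f : Module.End K V) :
    ∃ (g : Module.End K V) (v : V), Commute f g ∧ ∀ w, ∃ p : K[X], aeval g p v = w := by
  classical
  obtain ⟨ι, _, p, hp, d, ⟨e₀⟩⟩ := Module.equiv_directSum_of_isTorsion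
    (Module.AEval.isTorsion_of_finiteDimensional K V f)
  let e := e₀.trans (DirectSum.linearEquivFunOnFintype K[X] ι fun i => K[X] ⧸ K[X] ∙ p i ^ d i)
  let o := Module.AEval.of K V f
  have hroot (i : ι) : ∃ a, p i ∣ X - C a := by
    obtain ⟨a, ha⟩ := IsAlgClosed.exists_root (p i) (degree_pos_of_irreducible (hp i)).ne'
    exact ⟨a, ((irreducible_X_sub_C a).associated_of_dvd (hp i) (dvd_iff_isRoot.2 ha)).symm.dvd⟩
  choose a ha using hroot
  let ξ : ι ↪ K := (Fintype.equivFin ι).toEmbedding.trans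
    (Fin.valEmbedding.trans (Infinite.natEmbedding K))
  let c : ι → K := fun i => ξ i - a i
  have hC (t : K) (m : V) : e (o (t • m)) = C t • e (o m) := by
    rw [← map_smul e, Module.AEval.C_smul, map_smul o]
  let g : Module.End K V :=
    { toFun := fun m => o.symm (e.symm fun i => (X + C (c i)) • e (o m) i)
      map_add' := fun m m' => by
        rw [← map_add o.symm, ← map_add e.symm]
        congr 2
        ext1 i
        simp [smul_add]
      map_smul' := fun t m => by
        apply o.injective
        apply e.injective
        rw [RingHom.id_apply, hC, hC]
        simp only [LinearEquiv.apply_symm_apply]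
        ext1 i
        simp only [Pi.smul_apply]
        rw [smul_comm] }
  have hg (m : V) (i : ι) : e (o (g m)) i = (X + C (c i)) • e (o m) i := by
    simp [g]
  have hgp (q : K[X]) (m : V) (i : ι) :
      e (o (aeval g q m)) i = q.comp (X + C (c i)) • e (o m) i := by
    induction q using Polynomial.induction_on' generalizing m with
    | add q r hq hr => simp [hq, hr, add_smul]
    | monomial k t =>
      rw [aeval_monomial, ← C_mul_X_pow_eq_monomial, Module.algebraMap_end_eq_smul_id]
      simp only [mul_comp, C_comp, X_pow_comp, mul_smul]
      change e (o (t • (g ^ k) m)) i = _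
      rw [hC, Pi.smul_apply]
      congr 1
      induction k generalizing m with
      | zero => simp
      | succ k ih => rw [pow_succ, Module.End.mul_apply, ih, hg, pow_succ, mul_smul]
  refine ⟨g, o.symm (e.symm fun _ => Submodule.Quotient.mk 1), ?_, fun w => ?_⟩
  · ext m
    apply o.injective
    apply e.injective
    ext1 i
    have hf (m : V) : e (o (f m)) = (X : K[X]) • e (o m) := by
      rw [← map_smul e]
      congr 1
      exact (Module.AEval.X_smul_of f m).symm
    simp only [Module.End.mul_apply]
    rw [hf, Pi.smul_apply, hg, hg, hf, Pi.smul_apply, smul_comm]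
  · choose r hr using fun i => Submodule.Quotient.mk_surjective _ (e (o w) i)
    have hcop : Pairwise (Function.onFun IsCoprime
        fun i => Ideal.span {(X - C (ξ i)) ^ d i}) := by
      intro i j hij
      exact (Ideal.isCoprime_span_singleton_iff _ _).2
        (pairwise_coprime_X_sub_C ξ.injective hij).pow
    -- Substituting `X + C (c i)` turns this congruence into `q(X + c i) ≡ r i` modulo `(X - a i) ^
    -- d i`.
    obtain ⟨q, hq⟩ := Ideal.exists_forall_sub_mem_ideal hcop
      fun i => (r i).comp (X - C (c i))
    refine ⟨q, ?_⟩
    apply o.injective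
    apply e.injective
    ext1 i
    rw [hgp, ← hr]
    simp only [LinearEquiv.apply_symm_apply]
    rw [← Submodule.Quotient.mk_smul, Submodule.Quotient.eq, smul_eq_mul, mul_one,
      Submodule.mem_span_singleton]
    obtain ⟨u, hu⟩ := Ideal.mem_span_singleton.1 (hq i)
    have hu' := congrArg (fun z : K[X] => z.comp (X + C (c i))) hu
    simp only [sub_comp, mul_comp, pow_comp, X_comp, C_comp, comp_assoc] at hu'
    obtain ⟨z, hz⟩ := pow_dvd_pow_of_dvd (ha i) (d i)
    have hX : X + C (c i) - C (ξ i) = X - C (a i) := by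
      simp only [c, C_sub]
      ring
    rw [add_sub_cancel_right, comp_X, hX, hz] at hu'
    refine ⟨z * u.comp (X + C (c i)), ?_⟩
    rw [hu', smul_eq_mul]
    ring

theorem exists_cyclic_commuting_matrix {K : Type*} [Field K] [IsAlgClosed K] {n : ℕ}
    (A : Matrix (Fin n) (Fin n) K) :
    ∃ (R : Matrix (Fin n) (Fin n) K) (v : Fin n → K), Commute A R ∧ (krylov R v).det ≠ 0 := by
  obtain ⟨g, v, hg, hv⟩ := exists_cyclic_commuting_end (Matrix.toLinAlgEquiv' A)
  refine ⟨Matrix.toLinAlgEquiv'.symm g, v, ?_, krylov_det_ne_zero fun w => ?_⟩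
  · simpa using hg.map (Matrix.toLinAlgEquiv' (R := K) (n := Fin n)).symm
  · obtain ⟨p, hp⟩ := hv w
    refine ⟨p, ?_⟩
    rw [← hp, ← AlgEquiv.coe_toAlgHom, aeval_algHom_apply, ← Matrix.toLinAlgEquiv'_apply]
    simp

/-! ### Gerstenhaber's theorem -/

theorem isOpen_setOf_linearIndependent_matrix (m n : ℕ) :
    IsOpen {P : Fin m → Matrix (Fin n) (Fin n) ℂ | LinearIndependent ℂ P} :=
  isOpen_setOfPred_linearIndependent (𝕜 := ℂ) (E := Fin n → Fin n → ℂ)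

/-- Gerstenhaber's theorem: two commuting complex `n × n` matrices generate an algebra of dimension
at most `n`. The pair `(A, B)` is the limit of pairs `(A, B + t R)` with `B + t R` cyclic. -/
theorem finrank_adjoin_pair_le {n : ℕ} {A B : Matrix (Fin n) (Fin n) ℂ} (hAB : Commute A B) :
    Module.finrank ℂ (Algebra.adjoin ℂ ({A, B} : Set (Matrix (Fin n) (Fin n) ℂ))) ≤ n := by
  by_contra! hlt
  obtain ⟨R, v, hAR, hv⟩ := exists_cyclic_commuting_matrix A
  -- Evaluation of noncommutative polynomials at `(A, B + t R)`; lifting to the free algebra lets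
  -- the same `w k` be evaluated at every `t`.
  let φ : ℂ → FreeAlgebra ℂ (Fin 2) →ₐ[ℂ] Matrix (Fin n) (Fin n) ℂ :=
    fun t => FreeAlgebra.lift ℂ ![A, B + t • R]
  have hcont (w : FreeAlgebra ℂ (Fin 2)) : Continuous fun t => φ t w := by
    induction w using FreeAlgebra.induction with
    | grade0 r => simpa using continuous_const
    | grade1 i =>
      fin_cases i
      · simpa [φ] using continuous_const
      · simp only [φ, FreeAlgebra.lift_ι_apply]
        change Continuous fun t : ℂ => B + t • R
        fun_prop
    | mul a b ha hb => simpa using ha.matrix_mul hb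
    | add a b ha hb => simpa using! ha.add hb
  obtain ⟨P, hP⟩ := exists_linearIndependent_of_le_finrank (Nat.succ_le_of_lt hlt)
  have hP' : LinearIndependent ℂ fun k => (P k : Matrix (Fin n) (Fin n) ℂ) :=
    hP.map_injOn (Subalgebra.val _).toLinearMap Subtype.val_injective.injOn
  have hrange : Algebra.adjoin ℂ ({A, B} : Set (Matrix (Fin n) (Fin n) ℂ)) = (φ 0).range := by
    rw [← Algebra.adjoin_range_eq_range_freeAlgebra_lift]
    simp [Matrix.range_cons, Set.pair_comm]
  have hw (k : Fin (n + 1)) : ∃ w, φ 0 w = P k := by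
    exact hrange.le (P k).2
  choose w hw using hw
  have hopen : ∀ᶠ t in nhds (0 : ℂ), LinearIndependent ℂ fun k => φ t (w k) := by
    have hc : Continuous fun t => fun k => φ t (w k) := continuous_pi fun k => hcont (w k)
    refine ((isOpen_setOf_linearIndependent_matrix _ _).preimage hc).mem_nhds ?_
    simp only [Set.mem_preimage, Set.mem_ofPred_eq, hw]
    exact hP'
  have hfin : {t : ℂ | (krylov (R + t⁻¹ • B) v).det = 0}.Finite :=
    (finite_setOf_krylov_det_eq_zero hv B).preimage inv_injective.injOn
  have hgen : ∀ᶠ t in nhdsWithin (0 : ℂ) {0}ᶜ, (krylov (R + t⁻¹ • B) v).det ≠ 0 := by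
    have := hfin.sdiff (t := {0}) |>.isClosed.isOpen_compl.mem_nhds (x := (0 : ℂ)) (by simp)
    filter_upwards [nhdsWithin_le_nhds this, self_mem_nhdsWithin] with t ht h0 h
    exact ht ⟨h, h0⟩
  obtain ⟨t, ⟨hli, hdet⟩, ht⟩ :=
    ((hopen.filter_mono nhdsWithin_le_nhds).and hgen).and self_mem_nhdsWithin |>.exists
  have ht0 : t ≠ 0 := ht
  have hM : R + t⁻¹ • B = t⁻¹ • (B + t • R) := by
    rw [smul_add, smul_smul, inv_mul_cancel₀ ht0, one_smul, add_comm]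
  refine absurd (card_le_of_linearIndependent_of_commute hdet hli fun k => ?_) (by omega)
  rw [hM]
  refine Commute.smul_right ?_ _
  have hAM : Commute A (B + t • R) := hAB.add_right (hAR.smul_right t)
  generalize w k = x
  induction x using FreeAlgebra.induction with
  | grade0 r => simpa using Algebra.commute_algebraMap_left r _
  | grade1 i =>
    fin_cases i
    · simpa [φ] using hAM
    · simp [φ]
  | mul a b ha hb => simpa using ha.mul_left hb
  | add a b ha hb => simpa using ha.add_left hb

/-! ### Commutators with positive irreducible matrices -/

open scoped ComplexOrder in
theorem IsPositiveMatrix.pow {n : ℕ} {A : Matrix (Fin n) (Fin n) ℂ} (hA : IsPositiveMatrix A)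
    (k : ℕ) : IsPositiveMatrix (A ^ k) := by
  induction k with
  | zero =>
    intro i j
    rw [pow_zero, Matrix.one_apply]
    split_ifs <;> simp
  | succ k ih =>
    intro i j
    rw [pow_succ, Matrix.mul_apply]
    exact Finset.sum_nonneg fun l _ => mul_nonneg (ih i l) (hA l j)

open scoped ComplexOrder in
/-- The digraph of a positive ideal-irreducible matrix is strongly connected. -/
theorem IsIdealIrreducible.exists_pow_apply_ne_zero {n : ℕ} {A : Matrix (Fin n) (Fin n) ℂ}
    (hA : IsPositiveMatrix A) (hirr : IsIdealIrreducible A) (j i : Fin n) :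
    ∃ k : ℕ, (A ^ k) j i ≠ 0 := by
  by_contra! hj
  -- Vectors supported on the indices from which `i` can be reached: the ideal contains the `i`-th
  -- unit vector but not the `j`-th.
  refine hirr ⟨{ carrier := {x | ∀ l, (∀ k : ℕ, (A ^ k) l i = 0) → x l = 0}
                 add_mem' := ?_, zero_mem' := ?_, smul_mem' := ?_ }, ?_, ?_, ?_, ?_⟩
  · intro x y hx hy l hl
    simp [hx l hl, hy l hl]
  · intro l _
    rfl
  · intro t x hx l hl
    simp [hx l hl]
  · intro x hx y hxy l hl
    have := hxy l
    simpa [hx l hl] using this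
  · intro h
    have : (Pi.single i 1 : Fin n → ℝ) ∈ (⊥ : Submodule ℝ (Fin n → ℝ)) := by
      rw [← h]
      intro l hl
      refine Pi.single_eq_of_ne ?_ _
      rintro rfl
      simpa using hl 0
    simp at this
  · intro h
    have : (Pi.single j 1 : Fin n → ℝ) ∈ (⊤ : Submodule ℝ (Fin n → ℝ)) := Submodule.mem_top
    rw [← h] at this
    simpa using this j hj
  · intro x hx
    have key (l : Fin n) (hl : ∀ k : ℕ, (A ^ k) l i = 0) :
        A.mulVec (fun j => (x j : ℂ)) l = 0 := by
      refine (Matrix.mulVec_apply_eq_sum _ _ _).trans (Finset.sum_eq_zero fun m _ => ?_)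
      by_cases hm : A l m = 0
      · simp [hm]
      · rw [hx m fun k => ?_]
        · simp
        · have h1 := hl (k + 1)
          rw [pow_succ', Matrix.mul_apply, Finset.sum_eq_zero_iff_of_nonneg
            fun q _ => mul_nonneg (hA l q) (hA.pow k q i)] at h1
          exact (mul_eq_zero.1 (h1 m (Finset.mem_univ m))).resolve_left hm
    exact ⟨fun l hl => by simp [key l hl], fun l hl => by simp [key l hl]⟩

open scoped ComplexOrder in
/-- A positive commutator `C` with a positive ideal-irreducible matrix `A` vanishes, since
`C * A ^ k` has trace zero for all `k`. -/
theorem commutator_eq_zero_of_isPositiveMatrix {n : ℕ} {A B : Matrix (Fin n) (Fin n) ℂ}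
    (hA : IsPositiveMatrix A) (hirr : IsIdealIrreducible A)
    (hC : IsPositiveMatrix (A * B - B * A)) : A * B - B * A = 0 := by
  ext i j
  obtain ⟨k, hk⟩ := hirr.exists_pow_apply_ne_zero hA j i
  have htr : ((A * B - B * A) * A ^ k).trace = 0 := by
    rw [sub_mul, Matrix.trace_sub, mul_assoc, Matrix.trace_mul_comm A, mul_assoc, mul_assoc,
      ← pow_succ, ← pow_succ', sub_self]
  have hnn (a b : Fin n) := mul_nonneg (hC a b) (hA.pow k b a)
  simp only [Matrix.trace, Matrix.diag, Matrix.mul_apply (N := A ^ k)] at htr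
  rw [Finset.sum_eq_zero_iff_of_nonneg fun a _ => Finset.sum_nonneg fun b _ => hnn a b] at htr
  have h1 := htr i (Finset.mem_univ i)
  rw [Finset.sum_eq_zero_iff_of_nonneg fun b _ => hnn i b] at h1
  exact (mul_eq_zero.1 (h1 j (Finset.mem_univ j))).resolve_right hk

theorem SemiCommute.symm {n : ℕ} {A B : Matrix (Fin n) (Fin n) ℂ} (h : SemiCommute A B) :
    SemiCommute B A := by
  rw [SemiCommute, neg_sub] at *
  exact h.symm

theorem SemiCommute.commute {n : ℕ} {A B : Matrix (Fin n) (Fin n) ℂ} (h : SemiCommute A B)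
    (hA : IsPositiveMatrix A) (hirr : IsIdealIrreducible A) : Commute A B := by
  rcases h with h | h
  · exact sub_eq_zero.1 (commutator_eq_zero_of_isPositiveMatrix hA hirr h)
  -- Replacing `B` by `-B` flips the sign of the commutator; `B` need not be positive.
  · have hneg : -(A * B - B * A) = A * -B - -B * A := by noncomm_ring
    rw [hneg] at h
    have := commutator_eq_zero_of_isPositiveMatrix hA hirr h
    rw [← hneg, neg_eq_zero] at this
    exact sub_eq_zero.1 this

theorem corollary3p1 (n : ℕ) (A B : Matrix (Fin n) (Fin n) ℂ)
    (hAB : SemiCommute A B)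
    (hirr : (IsPositiveMatrix A ∧ IsIdealIrreducible A) ∨
      (IsPositiveMatrix B ∧ IsIdealIrreducible B)) :
    A * B = B * A ∧
      Module.finrank ℂ (Algebra.adjoin ℂ ({A, B} : Set (Matrix (Fin n) (Fin n) ℂ))) ≤ n := by
  have hcomm : Commute A B := by
    rcases hirr with ⟨hp, hi⟩ | ⟨hp, hi⟩
    · exact hAB.commute hp hi
    · exact (hAB.symm.commute hp hi).symm
  exact ⟨hcomm, finrank_adjoin_pair_le hcomm⟩
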